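/- **Setting.** Let $\dot H^1(\mathbb R^3)$ be the closure of $C_c^\infty(\mathbb R^3)$ with respect to the $L^2$-norm of the gradient (so that $\dot H^1(\mathbb R^3)\subset L^6(\mathbb R^3)$), a Hilbert space with scalar product $(u,v)=\int_{\mathbb R^3}\nabla u\cdot\nabla v$, and let $\dot H^{-1}(\mathbb R^3)$ be its dual. For $f\in\dot H^{-1}(\mathbb R^3)$ let $(-\Delta)^{-1}f\in \dot H^1(\mathbb R^3)$ be the solution of $-\Delta u=f$ in $\mathbb R^3$. For $\Omega\subset\mathbb R^3$ let $\dot H^1_0(\Omega)=\{u\in\dot H^1(\mathbb R^3): u=0 \text{ a.e. in }\mathbb R^3\setminus\Omega\}$. Let $I$ be a finite or countable index set, $x_i\in\mathbb R^3$ and $r_i>0$ for $i\in I$, $\overline{B_i}=\overline{B_{r_i}(x_i)}$, $K=\bigcup_{i\in I}\overline{B_i}$, and $d_i=\inf_{j\neq i}|x_i-x_j|$ (with $d_i=\infty$ if there is no $j\ne i$). Suppose that, for constants $\mu_0\ge 0$ and $\kappa>1$, $$ r_i d_i^{-3}\le \mu_0 \quad\text{and}\quad \frac{d_i}{2}>\kappa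 r_i\qquad\text{for all } i\in I .$$ Let $Q_i$ be the orthogonal projection in $\dot H^1(\mathbb R^3)$ onto $\dot H^1_0(\mathbb R^3\setminus\overline{B_i})^\perp$, i.e. onto the functions that are harmonic outside $\overline{B_i}$. **Theorem 3.** There exists $\gamma_0>0$ depending only on $\mu_0$ and $\kappa$ such that the following holds for all such families of balls. The series $Lu=\sum_{j} e^{-|x_j|}Q_ju$ converges in $\dot H^1(\mathbb R^3)$ for every $u\in\dot H^1(\mathbb R^3)$ and defines a bounded operator $L$, and, for every $f\in\dot H^{-1}(\mathbb R^3)$ and every $0<\gamma<\gamma_0$, $$ \Bigl(1-\gamma\sum_{j}e^{-|x_j|}Q_j\Bigr)^N(-\Delta)^{-1}f\;\longrightarrow\; u\quad\text{in }\dot H^1(\mathbb R^3)\text{ as }N\to\infty, $$ where $u$ is the unique weak solution of the Dirichlet problem $$-\Delta u=f\ \text{ in }\mathbb R^3\setminus K,\qquad u=0\ \text{ in }K,$$ that is, the unique $u\in\dot H^1_0(\mathbb R^3\setminus K)$ with $\int_{\mathbb R^3}\nabla u\cdot\nabla v=\langle f,v\rangle$ for all $v\in\dot H^1_0(\mathbb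 R^3\setminus K)$. -/

import Mathlib

open MeasureTheory Filter Topology
open scoped NNReal ENNReal InnerProductSpace Gradient ContDiff

noncomputable section

/-- Euclidean three-space. -/
abbrev R3 : Type := EuclideanSpace ℝ (Fin 3)

instance fact_one_le_six : Fact ((1 : ℝ≥0∞) ≤ 6) := ⟨by norm_num⟩

theorem continuous_gradient_of_contDiff {φ : R3 → ℝ} (h : ContDiff ℝ ∞ φ) :
    Continuous (∇ φ) := by
  have h1 : Continuous (fderiv ℝ φ) := h.continuous_fderiv (by simp)
  exact (InnerProductSpace.toDual ℝ R3).symm.continuous.comp h1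

theorem norm_gradient_eq (φ : R3 → ℝ) (x : R3) : ‖∇ φ x‖ = ‖fderiv ℝ φ x‖ := by
  simp [gradient]

theorem gradient_add_of_contDiff {φ ψ : R3 → ℝ} (h : ContDiff ℝ ∞ φ) (h' : ContDiff ℝ ∞ ψ)
    (x : R3) : ∇ (φ + ψ) x = ∇ φ x + ∇ ψ x := by
  have h1 : DifferentiableAt ℝ φ x := h.differentiable (by simp) x
  have h2 : DifferentiableAt ℝ ψ x := h'.differentiable (by simp) x
  simp only [gradient, fderiv_add h1 h2, map_add]

theorem gradient_smul_of_contDiff {φ : R3 → ℝ} (h : ContDiff ℝ ∞ φ) (c : ℝ) (x : R3) :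
    ∇ (c • φ) x = c • ∇ φ x := by
  have h1 : DifferentiableAt ℝ φ x := h.differentiable (by simp) x
  simp only [gradient, fderiv_const_smul h1 c, map_smul]

/-- The pairs `(φ, ∇φ)` in `L⁶(ℝ³) × L²(ℝ³; ℝ³)` with `φ ∈ C_c^∞(ℝ³)`. -/
def testPairs : Submodule ℝ (Lp ℝ 6 (volume : Measure R3) × Lp R3 2 (volume : Measure R3)) where
  carrier := {p | ∃ φ : R3 → ℝ, ContDiff ℝ ∞ φ ∧ HasCompactSupport φ ∧
    p.1 =ᵐ[volume] φ ∧ p.2 =ᵐ[volume] ∇ φ}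
  zero_mem' := by
    refine ⟨0, contDiff_const, HasCompactSupport.zero, Lp.coeFn_zero _ _ _, ?_⟩
    filter_upwards [Lp.coeFn_zero R3 2 (volume : Measure R3)] with x hx
    rw [Prod.snd_zero, hx]
    simp [gradient]
  add_mem' := by
    rintro p q ⟨φ, hφ, hφc, h1, h2⟩ ⟨ψ, hψ, hψc, h3, h4⟩
    refine ⟨φ + ψ, hφ.add hψ, hφc.add hψc, ?_, ?_⟩
    · filter_upwards [h1, h3, Lp.coeFn_add p.1 q.1] with x a b c
      simp only [Prod.fst_add, c, Pi.add_apply, a, b]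
    · filter_upwards [h2, h4, Lp.coeFn_add p.2 q.2] with x a b c
      simp only [Prod.snd_add, c, Pi.add_apply, a, b, gradient_add_of_contDiff hφ hψ]
  smul_mem' := by
    rintro c p ⟨φ, hφ, hφc, h1, h2⟩
    refine ⟨c • φ, hφ.const_smul c, ?_, ?_, ?_⟩
    · exact hφc.comp_left (g := fun t => c • t) (smul_zero c)
    · filter_upwards [h1, Lp.coeFn_smul c p.1] with x a b
      simp only [Prod.smul_fst, b, Pi.smul_apply, a]
    · filter_upwards [h2, Lp.coeFn_smul c p.2] with x a b
      simp only [Prod.smul_snd, b, Pi.smul_apply, a, gradient_smul_of_contDiff hφ]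

/-- The constant of the Gagliardo–Nirenberg–Sobolev inequality `‖φ‖_{L⁶} ≤ C ‖∇φ‖_{L²}`. -/
def sobolevConst : ℝ≥0 := eLpNormLESNormFDerivOfEqInnerConst (volume : Measure R3) 2

theorem norm_fst_le_of_mem_testPairs
    {p : Lp ℝ 6 (volume : Measure R3) × Lp R3 2 (volume : Measure R3)} (hp : p ∈ testPairs) :
    ‖p.1‖ ≤ sobolevConst * ‖p.2‖ := by
  obtain ⟨φ, hφ, hφc, h1, h2⟩ := hp
  have key := eLpNorm_le_eLpNorm_fderiv_of_eq_inner (volume : Measure R3) (u := φ)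
    (hφ.of_le (by exact_mod_cast le_top)) hφc (p := 2) (p' := 6) (by norm_num)
    (by simp) (by simp; norm_num)
  have e1 : eLpNorm p.1 6 volume = eLpNorm φ 6 volume := eLpNorm_congr_ae h1
  have e2 : eLpNorm p.2 2 volume = eLpNorm (fderiv ℝ φ) 2 volume := by
    rw [eLpNorm_congr_ae h2]
    exact eLpNorm_congr_norm_ae (Eventually.of_forall fun x => norm_gradient_eq φ x)
  have key' : eLpNorm p.1 6 volume ≤ sobolevConst * eLpNorm p.2 2 volume := by
    rw [e1, e2]; exact_mod_cast key
  rw [Lp.norm_def, Lp.norm_def]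
  have := ENNReal.toReal_mono (ENNReal.mul_ne_top ENNReal.coe_ne_top (Lp.eLpNorm_ne_top p.2)) key'
  simpa [ENNReal.toReal_mul] using this

/-- The homogeneous Sobolev space `Ḣ¹(ℝ³)`: the closure of `C_c^∞(ℝ³)` with respect to the
`L²` norm of the gradient. An element is stored as the pair `(u, ∇u)`, the limit in
`L⁶(ℝ³) × L²(ℝ³; ℝ³)` of pairs `(φₙ, ∇φₙ)` with `φₙ ∈ C_c^∞(ℝ³)`; by the Sobolev inequality,
convergence of the gradients in `L²` implies convergence of the functions in `L⁶`. -/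
def HDot1 : Type := testPairs.topologicalClosure

namespace HDot1

instance instAddCommGroup : AddCommGroup HDot1 :=
  inferInstanceAs (AddCommGroup testPairs.topologicalClosure)

instance instModule : Module ℝ HDot1 :=
  inferInstanceAs (Module ℝ testPairs.topologicalClosure)

/-- The function `u ∈ L⁶(ℝ³)`. -/
def fn : HDot1 →ₗ[ℝ] Lp ℝ 6 (volume : Measure R3) :=
  (LinearMap.fst ℝ _ _).comp testPairs.topologicalClosure.subtype

/-- The (weak) gradient `∇u ∈ L²(ℝ³; ℝ³)`. -/
def grad : HDot1 →ₗ[ℝ] Lp R3 2 (volume : Measure R3) :=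
  (LinearMap.snd ℝ _ _).comp testPairs.topologicalClosure.subtype

theorem norm_fn_le (u : HDot1) : ‖fn u‖ ≤ sobolevConst * ‖grad u‖ := by
  have hu : (u.1 : Lp ℝ 6 (volume : Measure R3) × Lp R3 2 (volume : Measure R3)) ∈
      closure (testPairs : Set _) := u.2
  have hc : IsClosed {p : Lp ℝ 6 (volume : Measure R3) × Lp R3 2 (volume : Measure R3) |
      ‖p.1‖ ≤ sobolevConst * ‖p.2‖} :=
    isClosed_le (by fun_prop) (by fun_prop)
  exact closure_minimal (fun p hp => norm_fst_le_of_mem_testPairs hp) hc hu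

theorem grad_injective : Function.Injective grad := by
  rw [← LinearMap.ker_eq_bot, LinearMap.ker_eq_bot']
  intro u hu
  have h := norm_fn_le u
  rw [hu, norm_zero, mul_zero] at h
  have h' : fn u = 0 := norm_le_zero_iff.mp h
  exact Subtype.ext (Prod.ext h' hu)

/-- The norm of `Ḣ¹(ℝ³)` is `‖∇u‖_{L²}`. -/
instance instNormedAddCommGroup : NormedAddCommGroup HDot1 :=
  NormedAddCommGroup.induced HDot1 (Lp R3 2 (volume : Measure R3)) grad grad_injective

theorem norm_def (u : HDot1) : ‖u‖ = ‖grad u‖ := rfl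

/-- The scalar product of `Ḣ¹(ℝ³)` is `(∇u, ∇v)_{L²}`. -/
instance instInnerProductSpace : InnerProductSpace ℝ HDot1 where
  norm_smul_le c u := by simp [norm_def, norm_smul]
  inner u v := ⟪grad u, grad v⟫_ℝ
  norm_sq_eq_re_inner u := norm_sq_eq_re_inner (𝕜 := ℝ) (grad u)
  conj_inner_symm u v := inner_conj_symm (grad u) (grad v)
  add_left u v w := by rw [map_add]; exact inner_add_left (grad u) (grad v) (grad w)
  smul_left u v c := by rw [map_smul]; exact inner_smul_left (grad u) (grad v) c

theorem inner_def (u v : HDot1) : ⟪u, v⟫_ℝ = ⟪grad u, grad v⟫_ℝ := rfl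

instance instCompleteSpace : CompleteSpace HDot1 := by
  refine Metric.complete_of_cauchySeq_tendsto fun s hs => ?_
  have hg : CauchySeq fun n => grad (s n) := by
    rw [Metric.cauchySeq_iff] at hs ⊢
    intro ε hε
    obtain ⟨N, hN⟩ := hs ε hε
    exact ⟨N, hN⟩
  have hf : CauchySeq fun n => fn (s n) := by
    rw [Metric.cauchySeq_iff] at hs ⊢
    intro ε hε
    have hC : (0 : ℝ) < sobolevConst + 1 := by positivity
    obtain ⟨N, hN⟩ := hs (ε / (sobolevConst + 1)) (by positivity)
    refine ⟨N, fun m hm n hn => ?_⟩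
    have h1 := hN m hm n hn
    rw [dist_eq_norm, norm_def, lt_div_iff₀ hC] at h1
    rw [dist_eq_norm, ← map_sub]
    have h2 := norm_fn_le (s m - s n)
    nlinarith [norm_nonneg (grad (s m - s n))]
  obtain ⟨a, ha⟩ := cauchySeq_tendsto_of_complete hf
  obtain ⟨b, hb⟩ := cauchySeq_tendsto_of_complete hg
  have hab : (a, b) ∈ testPairs.topologicalClosure :=
    testPairs.isClosed_topologicalClosure.mem_of_tendsto (ha.prodMk_nhds hb)
      (Eventually.of_forall fun n => (s n).2)
  let u : HDot1 := ⟨(a, b), hab⟩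
  refine ⟨u, ?_⟩
  rw [tendsto_iff_dist_tendsto_zero] at hb ⊢
  exact hb

end HDot1

/-- `Ḣ⁻¹(ℝ³)`, the dual space of `Ḣ¹(ℝ³)`. -/
abbrev HDotNeg1 : Type := StrongDual ℝ HDot1

/-- `Ḣ¹₀(Ω)`, the space of all `u ∈ Ḣ¹(ℝ³)` with `u = 0` in `ℝ³ ∖ Ω`. -/
def HDot1Zero (Ω : Set R3) : Submodule ℝ HDot1 where
  carrier := {u | ∀ᵐ y ∂(volume : Measure R3), y ∉ Ω → HDot1.fn u y = 0}
  zero_mem' := by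
    have h : HDot1.fn 0 = 0 := map_zero _
    filter_upwards [Lp.coeFn_zero ℝ 6 (volume : Measure R3)] with y hy _
    rw [h, hy, Pi.zero_apply]
  add_mem' := by
    intro u v hu hv
    filter_upwards [hu, hv, Lp.coeFn_add (HDot1.fn u) (HDot1.fn v)] with y h1 h2 h3 hy
    rw [map_add, h3, Pi.add_apply, h1 hy, h2 hy, add_zero]
  smul_mem' := by
    intro c u hu
    filter_upwards [hu, Lp.coeFn_smul c (HDot1.fn u)] with y h1 h2 hy
    rw [map_smul, h2, Pi.smul_apply, h1 hy, smul_zero]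

/-- `(-Δ)⁻¹ f`, the solution of the Poisson equation in the whole space: the unique
`u ∈ Ḣ¹(ℝ³)` with `(∇u, ∇v)_{L²} = ⟨f, v⟩` for all `v ∈ Ḣ¹(ℝ³)`. -/
def invNegLaplacian (f : HDotNeg1) : HDot1 := (InnerProductSpace.toDual ℝ HDot1).symm f

/-- The orthogonal projection in `Ḣ¹(ℝ³)` onto the orthogonal complement of
`Ḣ¹₀(ℝ³ ∖ B)`, where `B` is the closed ball with center `c` and radius `ρ`. -/
def reflectionProjection (c : R3) (ρ : ℝ) : HDot1 →L[ℝ] HDot1 :=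
  (HDot1Zero (Metric.closedBall c ρ)ᶜ)ᗮ.starProjection

/-- Weak solutions `u ∈ Ḣ¹(ℝ³)` of `-Δu = f` in `ℝ³ ∖ K`, `u = 0` in `K`. -/
structure IsDirichletSolution (K : Set R3) (f : HDotNeg1) (u : HDot1) : Prop where
  eq_zero : ∀ᵐ y ∂(volume : Measure R3), y ∈ K → HDot1.fn u y = 0
  weak_eq : ∀ v ∈ HDot1Zero Kᶜ,
    ∫ y, ⟪HDot1.grad u y, HDot1.grad v y⟫_ℝ ∂(volume : Measure R3) = f v

/-- The distance of the `i`-th center to the closest other center (`∞` if there is no other). -/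
def nearestDist {I : Type*} (x : I → R3) (i : I) : ℝ≥0∞ :=
  ⨅ j : I, ⨅ _ : j ≠ i, edist (x i) (x j)

/-- Admissible particles with centers `x i` and radii `r i`, for the bound `μ₀` of the capacity
density and the separation constant `κ`. -/
structure IsParticleConfig {I : Type*} (x : I → R3) (r : I → ℝ) (μ₀ : ℝ≥0) (κ : ℝ) : Prop where
  radius_pos : ∀ i, 0 < r i
  capacity : ∀ i, ENNReal.ofReal (r i) / nearestDist x i ^ 3 ≤ μ₀
  separated : ∀ i, ENNReal.ofReal (κ * r i) < nearestDist x i / 2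

end

/-! Everything reduces to one quadratic form bound, `exists_sum_exp_mul_norm_sq_le`: the sum of
e^{-|x_i|} ‖Q_i u‖² over any finite set of particles is at most C ‖u‖², with C depending only on μ₀
and κ. Given this, Hilbert space theory makes L bounded and symmetric with ‖Lu‖² ≤ C ⟪Lu, u⟫, and
its kernel is the intersection of the kernels of the Q_i, that is Ḣ¹₀(ℝ³ ∖ K). For 0 < γ < 1/C the
powers of 1 - γL converge strongly to the projection onto this kernel (`tendsto_pow_id_sub_smul`),
and the projection of (-Δ)⁻¹f is the Dirichlet solution.

For the bound, place disjoint balls of radii ρ_i = min(d_i, 1)/2 around the centers. If d_i < 1,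
then Q_i u costs no more energy than u times a cutoff at scale r_i, which
`exists_cutoff_integral_sq_fderiv_mul_le` controls by the integral of |∇u|² + (r_i/ρ_i³) u² over the
i-th ball. Here r_i/ρ_i³ ≤ 8μ₀, and the weight e^{-|x_i|} lets Hardy's inequality absorb the u²
terms after summation. If d_i ≥ 1, the trivial bound ‖Q_i u‖ ≤ ‖u‖ suffices, because disjoint balls
of fixed size make the sum of e^{-|x_i|} over such i bounded. -/

/-! ### Weighted sums of orthogonal projections in a Hilbert space. -/

section WeightedProjections

variable {H : Type*} [NormedAddCommGroup H] [InnerProductSpace ℝ H]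

/-- This is duality: `hb` bounds the map u ↦ (√a_i Q_i u) into ℓ², and the weighted sum w is the
adjoint applied to this sequence. Concretely, ‖w‖² is a sum of pairings of Q_i u with Q_i w; Young's
inequality and `hb` at w leave ‖w‖²/2, which is absorbed. -/
theorem norm_sq_sum_smul_starProjection_le {I : Type*} (K : I → Submodule ℝ H)
    [∀ i, (K i).HasOrthogonalProjection] {a : I → ℝ} (ha : ∀ i, 0 ≤ a i) {C : ℝ} (hC : 0 < C)
    (hb : ∀ (s : Finset I) (u : H), ∑ i ∈ s, a i * ‖(K i).starProjection u‖ ^ 2 ≤ C * ‖u‖ ^ 2)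
    (s : Finset I) (u : H) :
    ‖∑ i ∈ s, a i • (K i).starProjection u‖ ^ 2 ≤
      C * ∑ i ∈ s, a i * ‖(K i).starProjection u‖ ^ 2 := by
  set w := ∑ i ∈ s, a i • (K i).starProjection u with hw
  have h1 : ‖w‖ ^ 2 = ∑ i ∈ s, a i * ⟪(K i).starProjection u, (K i).starProjection w⟫_ℝ := by
    rw [← real_inner_self_eq_norm_sq]
    nth_rewrite 1 [hw]
    rw [sum_inner]
    refine Finset.sum_congr rfl fun i _ => ?_
    rw [real_inner_smul_left, ← Submodule.inner_starProjection_left_eq_right,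
      Submodule.starProjection_eq_self_iff.mpr (Submodule.starProjection_apply_mem _ _)]
  have h2 : ∀ i ∈ s, a i * ⟪(K i).starProjection u, (K i).starProjection w⟫_ℝ ≤
      C / 2 * (a i * ‖(K i).starProjection u‖ ^ 2) +
        C⁻¹ / 2 * (a i * ‖(K i).starProjection w‖ ^ 2) := by
    intro i _
    have h := real_inner_le_norm ((K i).starProjection u) ((K i).starProjection w)
    set p := ‖(K i).starProjection u‖
    set q := ‖(K i).starProjection w‖
    have h3 : p * q ≤ C / 2 * p ^ 2 + C⁻¹ / 2 * q ^ 2 := by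
      have h4 : 0 ≤ C⁻¹ / 2 * (C * p - q) ^ 2 := by positivity
      have h5 : C⁻¹ / 2 * (C * p - q) ^ 2 = C / 2 * p ^ 2 + C⁻¹ / 2 * q ^ 2 - p * q := by
        field_simp
        ring
      linarith
    calc _ ≤ a i * (C / 2 * p ^ 2 + C⁻¹ / 2 * q ^ 2) :=
          mul_le_mul_of_nonneg_left (h.trans h3) (ha i)
      _ = _ := by ring
  have h3 := Finset.sum_le_sum h2
  rw [← h1, Finset.sum_add_distrib, ← Finset.mul_sum, ← Finset.mul_sum] at h3
  have h4 : C⁻¹ / 2 * ∑ i ∈ s, a i * ‖(K i).starProjection w‖ ^ 2 ≤ ‖w‖ ^ 2 / 2 := by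
    calc _ ≤ C⁻¹ / 2 * (C * ‖w‖ ^ 2) := mul_le_mul_of_nonneg_left (hb s w) (by positivity)
      _ = _ := by field_simp
  linarith

/-- A weighted family of orthogonal projections with uniformly bounded quadratic form sums up to a
bounded symmetric operator `L` with `‖L u‖² ≤ C ⟪L u, u⟫`, whose kernel is the intersection of the
kernels of the projections. -/
theorem exists_hasSum_smul_starProjection [CompleteSpace H] {I : Type*} (K : I → Submodule ℝ H)
    [∀ i, (K i).HasOrthogonalProjection] {a : I → ℝ} (ha : ∀ i, 0 < a i) {C : ℝ} (hC : 0 < C)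
    (hb : ∀ (s : Finset I) (u : H), ∑ i ∈ s, a i * ‖(K i).starProjection u‖ ^ 2 ≤ C * ‖u‖ ^ 2) :
    ∃ L : H →L[ℝ] H, (∀ u, HasSum (fun i => a i • (K i).starProjection u) (L u)) ∧
      (L : H →ₗ[ℝ] H).IsSymmetric ∧ (∀ u, ‖L u‖ ^ 2 ≤ C * ⟪L u, u⟫_ℝ) ∧
      ∀ u, L u = 0 ↔ ∀ i, (K i).starProjection u = 0 := by
  have ha' : ∀ i, 0 ≤ a i := fun i => (ha i).le
  have hq := norm_sq_sum_smul_starProjection_le K ha' hC hb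
  have hs : ∀ u, Summable fun i => a i * ‖(K i).starProjection u‖ ^ 2 := fun u =>
    summable_of_sum_le (fun i => mul_nonneg (ha' i) (sq_nonneg _)) fun s => hb s u
  -- Cauchy criterion: the norms of finite partial sums of vectors are controlled by the
  -- corresponding sums of the convergent scalar series.
  have hS : ∀ u, Summable fun i => a i • (K i).starProjection u := by
    intro u
    rw [summable_iff_vanishing_norm]
    intro ε hε
    obtain ⟨s, h⟩ := summable_iff_vanishing_norm.mp (hs u) (ε ^ 2 / C) (by positivity)
    refine ⟨s, fun t ht => ?_⟩
    have h1 := (le_abs_self _).trans_lt (h t ht)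
    rw [lt_div_iff₀ hC] at h1
    exact lt_of_pow_lt_pow_left₀ 2 hε.le ((hq t u).trans_lt (by linarith))
  let T : H →ₗ[ℝ] H :=
    { toFun := fun u => ∑' i, a i • (K i).starProjection u
      map_add' := fun u v => by
        rw [← (hS u).tsum_add (hS v)]
        simp only [map_add, smul_add]
      map_smul' := fun c u => by
        rw [RingHom.id_apply, ← (hS u).tsum_const_smul c]
        simp only [map_smul, smul_comm c] }
  have hT : ∀ u, HasSum (fun i => a i • (K i).starProjection u) (T u) := fun u => (hS u).hasSum
  have hinner : ∀ u v, HasSum (fun i => a i * ⟪(K i).starProjection u, (K i).starProjection v⟫_ℝ)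
      ⟪T u, v⟫_ℝ := by
    intro u v
    have h := (hT u).mapL ((innerSL ℝ).flip v)
    simp only [ContinuousLinearMap.flip_apply, innerSL_apply_apply] at h
    refine Eq.mp (congrArg (HasSum · _) (funext fun i => ?_)) h
    symm
    rw [real_inner_smul_left, ← Submodule.inner_starProjection_left_eq_right,
      Submodule.starProjection_eq_self_iff.mpr (Submodule.starProjection_apply_mem _ _)]
  have hinner' : ∀ u, HasSum (fun i => a i * ‖(K i).starProjection u‖ ^ 2) ⟪T u, u⟫_ℝ := by
    intro u
    simpa only [real_inner_self_eq_norm_sq] using hinner u u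
  have hTq : ∀ u, ‖T u‖ ^ 2 ≤ C * ⟪T u, u⟫_ℝ := by
    intro u
    refine le_of_tendsto_of_tendsto' (((hT u).norm).pow 2) ((hinner' u).const_mul C) fun s => ?_
    exact hq s u
  have hTb : ∀ u, ‖T u‖ ≤ C * ‖u‖ := by
    intro u
    have h1 := hTq u
    have h2 : C * ⟪T u, u⟫_ℝ ≤ C * (‖T u‖ * ‖u‖) :=
      mul_le_mul_of_nonneg_left (real_inner_le_norm _ _) hC.le
    by_contra! h3
    nlinarith [norm_nonneg (T u), norm_nonneg u, mul_nonneg hC.le (norm_nonneg u)]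
  refine ⟨T.mkContinuous C hTb, hT, ?_, hTq, fun u => ⟨fun h i => ?_, fun h => ?_⟩⟩
  · intro u v
    change ⟪T u, v⟫_ℝ = ⟪u, T v⟫_ℝ
    rw [real_inner_comm (T v) u]
    refine (hinner u v).unique ?_
    refine Eq.mp (congrArg (HasSum · _) (funext fun i => ?_)) (hinner v u)
    rw [real_inner_comm]
  -- ⟪Tu, u⟫ is a sum of nonnegative terms with strictly positive weights, so it vanishes only if
  -- every projection does.
  · have h0 : T u = 0 := h
    have h1 := hinner' u
    rw [h0, inner_zero_left,
      hasSum_zero_iff_of_nonneg fun i => mul_nonneg (ha' i) (sq_nonneg _)] at h1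
    have h2 := congrFun h1 i
    simpa [(ha i).ne'] using h2
  · change T u = 0
    refine (hT u).unique ?_
    simp [h]

/-- Powers of `1 - γ L` converge strongly to the orthogonal projection onto the kernel of `L`. -/
theorem tendsto_pow_id_sub_smul [CompleteSpace H] {L : H →L[ℝ] H} (hL : (L : H →ₗ[ℝ] H).IsSymmetric) {C γ : ℝ}
    (hC : 0 < C) (hq : ∀ u, ‖L u‖ ^ 2 ≤ C * ⟪L u, u⟫_ℝ) (hγ : 0 < γ) (hγC : γ < 1 / C) (u : H) :
    Tendsto (fun N : ℕ => ((ContinuousLinearMap.id ℝ H - γ • L) ^ N) u) atTop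
      (𝓝 ((L : H →ₗ[ℝ] H).ker.starProjection u)) := by
  set T := ContinuousLinearMap.id ℝ H - γ • L with hTdef
  have hTu : ∀ u, T u = u - γ • L u := fun u => by simp [hTdef]
  have hγC' : γ * C < 1 := by rwa [lt_div_iff₀ hC] at hγC
  -- The quantitative energy decrease: γ < 1/C makes the quadratic term at most half of what the
  -- cross term gains.
  have hdec : ∀ u, ‖T u‖ ^ 2 ≤ ‖u‖ ^ 2 - γ / C * ‖L u‖ ^ 2 := by
    intro u
    have h1 : ‖T u‖ ^ 2 = ‖u‖ ^ 2 - 2 * γ * ⟪L u, u⟫_ℝ + γ ^ 2 * ‖L u‖ ^ 2 := by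
      rw [hTu, norm_sub_sq_real, real_inner_smul_right, norm_smul, real_inner_comm, mul_pow,
        Real.norm_eq_abs, sq_abs]
      ring
    have h2 : ‖L u‖ ^ 2 / C ≤ ⟪L u, u⟫_ℝ := by
      rw [div_le_iff₀ hC]
      linarith [hq u]
    have h3 : γ ^ 2 * ‖L u‖ ^ 2 ≤ γ * (‖L u‖ ^ 2 / C) := by
      have : γ ^ 2 * ‖L u‖ ^ 2 = γ * C * (γ * (‖L u‖ ^ 2 / C)) := by field_simp
      rw [this]
      exact mul_le_of_le_one_left (by positivity) hγC'.le
    have h4 : γ / C * ‖L u‖ ^ 2 = γ * (‖L u‖ ^ 2 / C) := by ring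
    nlinarith
  have hle : ∀ u, ‖T u‖ ≤ ‖u‖ := fun u => by
    refine le_of_sq_le_sq ?_ (norm_nonneg u)
    have : 0 ≤ γ / C * ‖L u‖ ^ 2 := by positivity
    linarith [hdec u]
  have hpow : ∀ (N : ℕ) u, (T ^ (N + 1)) u = T ((T ^ N) u) := fun N u => by
    rw [pow_succ', mul_apply_eq_comp]
  have hpow_le : ∀ (N : ℕ) u, ‖(T ^ N) u‖ ≤ ‖u‖ := by
    intro N u
    induction N with
    | zero => simp
    | succ N ih => exact (hpow N u).symm ▸ (hle _).trans ih
  have hLT : Commute L T := by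
    rw [hTdef]
    exact ((Commute.one_right L).sub_right ((Commute.refl L).smul_right γ))
  -- Telescoping `hdec` along the orbit gives square summability of ‖L Tⁿ u‖.
  have hsum : ∀ u, Tendsto (fun N : ℕ => L ((T ^ N) u)) atTop (𝓝 0) := by
    intro u
    have hS : Summable fun N : ℕ => γ / C * ‖L ((T ^ N) u)‖ ^ 2 := by
      refine summable_of_sum_range_le (c := ‖u‖ ^ 2) (fun N => by positivity) fun n => ?_
      have : ∑ i ∈ Finset.range n, γ / C * ‖L ((T ^ i) u)‖ ^ 2 ≤ ‖u‖ ^ 2 - ‖(T ^ n) u‖ ^ 2 := by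
        induction n with
        | zero => simp
        | succ n ih =>
          rw [Finset.sum_range_succ, hpow]
          linarith [hdec ((T ^ n) u)]
      linarith [sq_nonneg ‖(T ^ n) u‖]
    have h1 := hS.tendsto_atTop_zero
    have h2 := (h1.const_mul (C / γ)).sqrt
    rw [tendsto_zero_iff_norm_tendsto_zero]
    convert h2 using 2 with N
    · rw [← mul_assoc, div_mul_div_cancel₀ hγ.ne', div_self hC.ne', one_mul,
        Real.sqrt_sq (norm_nonneg _)]
    · simp
  -- Since L commutes with T, `hsum` says that the powers tend to 0 on the range of L; contractivity
  -- extends this to the closure, which is the orthogonal complement of the kernel by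
  -- self-adjointness.
  have hrange : ∀ v ∈ (L : H →ₗ[ℝ] H).range.topologicalClosure,
      Tendsto (fun N : ℕ => (T ^ N) v) atTop (𝓝 0) := by
    intro v hv
    rw [Metric.tendsto_atTop]
    intro ε hε
    have hv' : v ∈ closure ((L : H →ₗ[ℝ] H).range : Set H) := hv
    obtain ⟨_, ⟨w, rfl⟩, hw⟩ := Metric.mem_closure_iff.mp hv' (ε / 2) (half_pos hε)
    obtain ⟨N₀, hN₀⟩ := Metric.tendsto_atTop.mp (hsum w) (ε / 2) (half_pos hε)
    refine ⟨N₀, fun N hN => ?_⟩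
    have h1 := hN₀ N hN
    have h2 : L ((T ^ N) w) = (T ^ N) (L w) :=
      congrArg (fun A : H →L[ℝ] H => A w) (hLT.pow_right N)
    rw [dist_zero_right, h2] at h1
    rw [dist_eq_norm] at hw
    have h3 : (T ^ N) v = (T ^ N) (v - L w) + (T ^ N) (L w) := by
      rw [← map_add, sub_add_cancel]
    rw [dist_zero_right, h3]
    have h4 := norm_add_le ((T ^ N) (v - L w)) ((T ^ N) (L w))
    have h5 := hpow_le N (v - L w)
    have h6 : ‖v - L w‖ < ε / 2 := hw
    linarith
  have hker : ∀ v ∈ (L : H →ₗ[ℝ] H).ker, ∀ N : ℕ, (T ^ N) v = v := by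
    intro v hv N
    have h0 : L v = 0 := hv
    induction N with
    | zero => simp
    | succ N ih => rw [hpow, ih, hTu, h0, smul_zero, sub_zero]
  have hsplit := Submodule.starProjection_add_starProjection_orthogonal
    (K := (L : H →ₗ[ℝ] H).ker) u
  have horth : (L : H →ₗ[ℝ] H).kerᗮ = (L : H →ₗ[ℝ] H).range.topologicalClosure := by
    rw [ContinuousLinearMap.orthogonal_ker,
      (ContinuousLinearMap.isSelfAdjoint_iff_isSymmetric.mpr hL).adjoint_eq]
  have hmem := (L : H →ₗ[ℝ] H).kerᗮ.starProjection_apply_mem u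
  have hlim := (hrange _ (horth.le hmem)).const_add ((L : H →ₗ[ℝ] H).ker.starProjection u)
  rw [add_zero] at hlim
  convert hlim using 2 with N
  conv_lhs => rw [← hsplit]
  rw [map_add, hker _ (Submodule.starProjection_apply_mem _ _)]

end WeightedProjections

/-! ### The divergence theorem for radial fields and Hardy's inequality. -/

section VectorFieldInequalities

theorem integral_fderiv_apply_single {ψ : R3 → ℝ} (hψ : ContDiff ℝ 1 ψ) (hc : HasCompactSupport ψ)
    (c : R3) (i : Fin 3) :
    ∫ y, (y - c) i * fderiv ℝ ψ y (EuclideanSpace.single i 1) = -∫ y, ψ y := by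
  have hd : Continuous fun y => fderiv ℝ ψ y (EuclideanSpace.single i 1) :=
    (hψ.continuous_fderiv one_ne_zero).clm_apply continuous_const
  have hdc : HasCompactSupport fun y => fderiv ℝ ψ y (EuclideanSpace.single i 1) :=
    hc.fderiv_apply ℝ _
  let f : R3 →L[ℝ] ℝ := EuclideanSpace.proj i
  have hf : ∀ y, fderiv ℝ (fun y => f (y - c)) y = f := fun y => by
    have : HasFDerivAt (fun y => f (y - c)) (f.comp (ContinuousLinearMap.id ℝ R3)) y :=
      f.hasFDerivAt.comp y ((hasFDerivAt_id y).sub_const c)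
    simpa using this.fderiv
  have hcont : Continuous fun y => f (y - c) := f.continuous.comp (continuous_id.sub continuous_const)
  have h1 : f (EuclideanSpace.single i 1) = 1 := by simp [f]
  have key := integral_mul_fderiv_eq_neg_fderiv_mul_of_integrable (μ := (volume : Measure R3))
    (f := fun y => f (y - c)) (g := ψ) (v := EuclideanSpace.single i 1) ?_ ?_ ?_ ?_ ?_
  · simp only [hf, h1, one_mul] at key
    exact key
  · simp only [hf, h1, one_mul]
    exact hψ.continuous.integrable_of_hasCompactSupport hc
  · exact (hcont.mul hd).integrable_of_hasCompactSupport hdc.mul_left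
  · exact (hcont.mul hψ.continuous).integrable_of_hasCompactSupport hc.mul_left
  · intro y _
    fun_prop
  · intro y _
    exact hψ.differentiable one_ne_zero y

/-- The integrand is the divergence of the compactly supported field ψ(y)(y - c). A suitable ψ thus
turns a pointwise inequality modulo this divergence into an integral inequality; Hardy's inequality
and the cutoff estimate both arise so. -/
theorem integral_fderiv_apply_sub_center {ψ : R3 → ℝ} (hψ : ContDiff ℝ 1 ψ)
    (hc : HasCompactSupport ψ) (c : R3) :
    ∫ y, (3 * ψ y + fderiv ℝ ψ y (y - c)) = 0 := by
  have hd : ∀ i : Fin 3, Continuous fun y => fderiv ℝ ψ y (EuclideanSpace.single i 1) := fun i =>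
    (hψ.continuous_fderiv one_ne_zero).clm_apply continuous_const
  have hsum : ∀ y, fderiv ℝ ψ y (y - c) =
      ∑ i : Fin 3, (y - c) i * fderiv ℝ ψ y (EuclideanSpace.single i 1) := fun y => by
    conv_lhs => rw [← (EuclideanSpace.basisFun (Fin 3) ℝ).sum_repr (y - c)]
    simp [map_sum]
  have hi : ∀ i : Fin 3,
      Integrable fun y => (y - c) i * fderiv ℝ ψ y (EuclideanSpace.single i 1) := fun i =>
    (Continuous.mul (by fun_prop) (hd i)).integrable_of_hasCompactSupport
      (hc.fderiv_apply ℝ _).mul_left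
  have hψi : Integrable ψ := hψ.continuous.integrable_of_hasCompactSupport hc
  simp only [hsum]
  rw [integral_add (hψi.const_mul 3) (integrable_finsetSum _ fun i _ => hi i),
    integral_finsetSum _ fun i _ => hi i, integral_const_mul]
  simp only [integral_fderiv_apply_single hψ hc]
  simp

theorem integrable_euler {ψ : R3 → ℝ} (hψ : ContDiff ℝ 1 ψ) (hc : HasCompactSupport ψ) (c : R3) :
    Integrable fun y => 3 * ψ y + fderiv ℝ ψ y (y - c) := by
  refine ((hψ.continuous.integrable_of_hasCompactSupport hc).const_mul 3).add ?_
  refine ((hψ.continuous_fderiv one_ne_zero).clm_apply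
    (continuous_id.sub continuous_const)).integrable_of_hasCompactSupport ?_
  exact (hc.fderiv ℝ).mono fun y hy h0 => hy (by simp only [h0, zero_apply])

theorem contDiff_inv_one_add_norm_sq : ContDiff ℝ ∞ fun y : R3 => (1 + ‖y‖ ^ 2)⁻¹ :=
  (contDiff_const.add (contDiff_norm_sq ℝ)).inv fun y => by positivity

theorem HasCompactSupport.of_eq_zero_imp {V : Type*} [Zero V] {f : R3 → ℝ} {g : R3 → V}
    (hc : HasCompactSupport g) (h : ∀ y, g y = 0 → f y = 0) : HasCompactSupport f :=
  hc.mono fun y hy hg => hy (h y hg)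

theorem integrable_sq_norm_fderiv {φ : R3 → ℝ} (hφ : ContDiff ℝ ∞ φ) (hc : HasCompactSupport φ) :
    Integrable fun y => ‖fderiv ℝ φ y‖ ^ 2 := by
  have h1 : Continuous fun y => ‖fderiv ℝ φ y‖ ^ 2 := (hφ.continuous_fderiv (by simp)).norm.pow 2
  refine h1.integrable_of_hasCompactSupport ?_
  exact (hc.fderiv ℝ).of_eq_zero_imp fun y hy => by simp [hy]

theorem integrable_inv_one_add_norm_sq_mul_sq {φ : R3 → ℝ} (hφ : ContDiff ℝ ∞ φ)
    (hc : HasCompactSupport φ) : Integrable fun y => (1 + ‖y‖ ^ 2)⁻¹ * φ y ^ 2 :=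
  (contDiff_inv_one_add_norm_sq.continuous.mul (hφ.continuous.pow 2)).integrable_of_hasCompactSupport
    (hc.of_eq_zero_imp fun y hy => by simp [hy])

/-- A form of Hardy's inequality. -/
theorem integral_inv_one_add_norm_sq_mul_sq_le {φ : R3 → ℝ} (hφ : ContDiff ℝ ∞ φ)
    (hc : HasCompactSupport φ) :
    ∫ y, (1 + ‖y‖ ^ 2)⁻¹ * φ y ^ 2 ≤ 4 * ∫ y, ‖fderiv ℝ φ y‖ ^ 2 := by
  set ψ : R3 → ℝ := fun y => (1 + ‖y‖ ^ 2)⁻¹ * φ y ^ 2 with hψdef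
  have hψ : ContDiff ℝ 1 ψ := (contDiff_inv_one_add_norm_sq.mul (hφ.pow 2)).of_le (by simp)
  have hψc : HasCompactSupport ψ :=
    hc.of_eq_zero_imp fun y hy => by simp [hψdef, hy]
  have hψi := integrable_inv_one_add_norm_sq_mul_sq hφ hc
  have hgi := integrable_sq_norm_fderiv hφ hc
  have hder : ∀ y, fderiv ℝ ψ y y = (1 + ‖y‖ ^ 2)⁻¹ * (2 * φ y * fderiv ℝ φ y y) -
      φ y ^ 2 * (2 * ‖y‖ ^ 2 * ((1 + ‖y‖ ^ 2)⁻¹) ^ 2) := fun y => by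
    have h1 : HasFDerivAt (fun y : R3 => 1 + ‖y‖ ^ 2) (2 • innerSL ℝ y) y :=
      (hasStrictFDerivAt_norm_sq y).hasFDerivAt.const_add 1
    have h2 := (hasDerivAt_inv (by positivity : (1 : ℝ) + ‖y‖ ^ 2 ≠ 0)).comp_hasFDerivAt y h1
    have h3 := ((hφ.differentiable (by simp) y).hasFDerivAt).pow 2
    have h4 : HasFDerivAt ψ _ y := h2.mul h3
    rw [h4.fderiv]
    simp
    ring
  -- With g = 1/(1+|y|²), the divergence equals gφ² + 2g²φ² + 2gφ(y·∇φ). Completing the square costs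
  -- gφ²/2 and 2g(y·∇φ)², and g|y|² ≤ 1.
  have hpt : ∀ y, ψ y / 2 - 2 * ‖fderiv ℝ φ y‖ ^ 2 ≤ 3 * ψ y + fderiv ℝ ψ y (y - 0) := fun y => by
    rw [sub_zero, hder, hψdef]
    have h1 : |fderiv ℝ φ y y| ≤ ‖fderiv ℝ φ y‖ * ‖y‖ := (fderiv ℝ φ y).le_opNorm y
    have h0 : (0 : ℝ) < 1 + ‖y‖ ^ 2 := by positivity
    set g := (1 + ‖y‖ ^ 2)⁻¹ with hg
    have hg0 : 0 < g := inv_pos.mpr h0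
    have hgs : g * ‖y‖ ^ 2 = 1 - g := by
      have : g * (1 + ‖y‖ ^ 2) = 1 := inv_mul_cancel₀ h0.ne'
      linarith
    have h2 : (fderiv ℝ φ y y) ^ 2 ≤ ‖fderiv ℝ φ y‖ ^ 2 * ‖y‖ ^ 2 := by
      rw [← mul_pow, ← sq_abs]
      gcongr
    have h3 : g * (fderiv ℝ φ y y) ^ 2 ≤ ‖fderiv ℝ φ y‖ ^ 2 := by
      calc _ ≤ g * (‖fderiv ℝ φ y‖ ^ 2 * ‖y‖ ^ 2) := by gcongr
        _ = ‖fderiv ℝ φ y‖ ^ 2 * (1 - g) := by rw [← hgs]; ring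
        _ ≤ _ := mul_le_of_le_one_right (sq_nonneg _) (by linarith)
    have h4 : 0 ≤ g * (φ y / 2 + fderiv ℝ φ y y) ^ 2 * 2 := by positivity
    have h5 : φ y ^ 2 * (2 * ‖y‖ ^ 2 * g ^ 2) = 2 * φ y ^ 2 * g * (1 - g) := by rw [← hgs]; ring
    have h6 : 0 ≤ φ y ^ 2 * g ^ 2 := by positivity
    rw [h5]
    nlinarith
  have hEi := integrable_euler hψ hψc 0
  have h1 := integral_mono ((hψi.div_const 2).sub (hgi.const_mul 2)) hEi hpt
  rw [integral_fderiv_apply_sub_center hψ hψc 0] at h1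
  rw [integral_sub' (hψi.div_const 2) (hgi.const_mul 2), integral_div, integral_const_mul] at h1
  linarith

end VectorFieldInequalities

/-! ### Cutting off at the scale of one particle. -/

section LocalCutoff

/-- Smooth cutoff functions between concentric balls with radii of fixed ratio, with a gradient
bound of the right scaling. -/
theorem exists_scaled_bump {k : ℝ} (hk : 1 < k) : ∃ M : ℝ, 0 < M ∧ ∀ (c : R3) (R : ℝ), 0 < R →
    ∃ θ : R3 → ℝ, ContDiff ℝ ∞ θ ∧ HasCompactSupport θ ∧ (∀ y, 0 ≤ θ y ∧ θ y ≤ 1) ∧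
      (∀ y, ‖y - c‖ ≤ R / k → θ y = 1) ∧ (∀ y, R ≤ ‖y - c‖ → θ y = 0) ∧
      ∀ y, ‖fderiv ℝ θ y‖ ≤ M / R := by
  let χ : ContDiffBump (0 : R3) := ⟨1 / k, 1, by positivity, (div_lt_one (by positivity)).mpr hk⟩
  obtain ⟨M, hM⟩ := (χ.hasCompactSupport.fderiv ℝ).exists_bound_of_continuous
    (χ.contDiff (n := 1) |>.continuous_fderiv one_ne_zero)
  refine ⟨|M| + 1, by positivity, fun c R hR => ?_⟩
  have hnorm : ∀ y : R3, ‖R⁻¹ • (y - c)‖ = ‖y - c‖ / R := fun y => by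
    rw [norm_smul, norm_inv, Real.norm_of_nonneg hR.le, div_eq_inv_mul]
  have hzero : ∀ y, R ≤ ‖y - c‖ → χ (R⁻¹ • (y - c)) = 0 := fun y hy => by
    refine χ.zero_of_le_dist ?_
    rw [dist_zero_right, hnorm]
    exact (one_le_div hR).mpr hy
  refine ⟨fun y => χ (R⁻¹ • (y - c)), ?_, ?_, fun y => ⟨χ.nonneg, χ.le_one⟩, fun y hy => ?_, hzero,
    fun y => ?_⟩
  · exact χ.contDiff.comp ((contDiff_id.sub contDiff_const).const_smul R⁻¹)
  · refine HasCompactSupport.intro (isCompact_closedBall c R) fun y hy => hzero y ?_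
    rw [Metric.mem_closedBall, not_le, dist_eq_norm] at hy
    exact hy.le
  · refine χ.one_of_mem_closedBall ?_
    rw [Metric.mem_closedBall, dist_zero_right, hnorm]
    change _ ≤ 1 / k
    rw [div_le_iff₀ hR]
    exact hy.trans_eq (by ring)
  · have hd : HasFDerivAt (fun y : R3 => R⁻¹ • (y - c)) (R⁻¹ • ContinuousLinearMap.id ℝ R3) y :=
      ((hasFDerivAt_id y).sub_const c).const_smul R⁻¹
    have hχ : HasFDerivAt χ _ (R⁻¹ • (y - c)) :=
      (χ.contDiff (n := 1) |>.differentiable one_ne_zero _).hasFDerivAt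
    change ‖fderiv ℝ (χ ∘ fun y => R⁻¹ • (y - c)) y‖ ≤ _
    rw [(hχ.comp y hd).fderiv, ContinuousLinearMap.comp_smul, ContinuousLinearMap.comp_id,
      norm_smul, norm_inv, Real.norm_of_nonneg hR.le, div_eq_inv_mul]
    gcongr
    exact (hM _).trans ((le_abs_self M).trans (by linarith))

/-- The values 0 and 1 are extremal. This confines the gradient of a cutoff to its transition shell.
-/
theorem fderiv_eq_zero_of_eq_zero_of_nonneg {θ : R3 → ℝ} (h : ∀ y, 0 ≤ θ y ∧ θ y ≤ 1) {y : R3}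
    (hy : θ y = 0 ∨ θ y = 1) : fderiv ℝ θ y = 0 := by
  rcases hy with hy | hy
  · exact IsLocalMin.fderiv_eq_zero (Eventually.of_forall fun z => hy ▸ (h z).1)
  · exact IsLocalMax.fderiv_eq_zero (Eventually.of_forall fun z => hy ▸ (h z).2)

theorem exists_hasFDerivAt_inv_sqrt {r : ℝ} (hr : 0 < r) (c y : R3) :
    ∃ q' : R3 →L[ℝ] ℝ, HasFDerivAt (fun y => (√(r ^ 2 + ‖y - c‖ ^ 2))⁻¹) q' y ∧
      q' (y - c) = -(‖y - c‖ ^ 2 * ((√(r ^ 2 + ‖y - c‖ ^ 2))⁻¹) ^ 3) := by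
  have h1 : HasFDerivAt (fun y : R3 => r ^ 2 + ‖y - c‖ ^ 2)
      ((2 • innerSL ℝ (y - c)).comp (ContinuousLinearMap.id ℝ R3)) y :=
    ((hasStrictFDerivAt_norm_sq (y - c)).hasFDerivAt.comp y
      ((hasFDerivAt_id y).sub_const c)).const_add _
  have h0 : 0 < r ^ 2 + ‖y - c‖ ^ 2 := by positivity
  have hs : 0 < √(r ^ 2 + ‖y - c‖ ^ 2) := Real.sqrt_pos.mpr h0
  have h2 := (h1.sqrt h0.ne')
  have h3 := (hasDerivAt_inv hs.ne').comp_hasFDerivAt y h2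
  refine ⟨_, h3, ?_⟩
  simp
  field_simp
  rw [← inner_sub_left, real_inner_self_eq_norm_sq]

/-- Here s = |y - c|, q = (r² + s²)^{-1/2}, D = |∇φ|, and dθ, dφ are derivatives along y - c; the
two middle groups form the divergence of θgφ²(y - c) with g = rq³ - r²q⁴/2. The second term of g
contributes r²q⁴/2 - 2r⁴q⁶ to the divergence of g(y - c), and the first contributes 3r³q⁵, which
outweighs the negative part since rq ≤ 1. As |g(y - c)| ≤ rq², the cross term is absorbed by half of
r²q⁴φ²/2 and by 4D². The term P pays for the cutoff θ. -/
theorem radial_weight_inequality {r s q θ dθ φ dφ D P : ℝ} (hr : 0 < r) (hq : 0 < q)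
    (hq2 : q ^ 2 * (r ^ 2 + s ^ 2) = 1) (hθ : 0 ≤ θ) (hD : 0 ≤ D)
    (hdθ : |dθ * (r * q ^ 3 - r ^ 2 / 2 * q ^ 4)| ≤ P) (hdφ : |dφ| ≤ s * D) :
    θ * (r ^ 2 * q ^ 4) * φ ^ 2 / 4 ≤
      3 * (θ * (r * q ^ 3 - r ^ 2 / 2 * q ^ 4) * φ ^ 2) +
      (dθ * (r * q ^ 3 - r ^ 2 / 2 * q ^ 4) * φ ^ 2 +
        θ * (-(s ^ 2 * (3 * r * q ^ 5 - 2 * r ^ 2 * q ^ 6))) * φ ^ 2 +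
        2 * θ * (r * q ^ 3 - r ^ 2 / 2 * q ^ 4) * φ * dφ) + (4 * θ * D ^ 2 + P * φ ^ 2) := by
  have hrq : r * q ≤ 1 := by
    refine le_of_sq_le_sq ?_ zero_le_one
    nlinarith [mul_nonneg (sq_nonneg q) (sq_nonneg s)]
  have hsq : s * q ≤ 1 := by
    refine le_of_sq_le_sq ?_ zero_le_one
    nlinarith [mul_nonneg (sq_nonneg q) (sq_nonneg r)]
  have hrq0 : 0 < r * q := by positivity
  set g := r * q ^ 3 - r ^ 2 / 2 * q ^ 4 with hg
  have hg' : g = r * q ^ 3 * (1 - r * q / 2) := by rw [hg]; ring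
  have hg0 : 0 ≤ g := by
    rw [hg']
    exact mul_nonneg (by positivity) (by linarith)
  have hg1 : g ≤ r * q ^ 3 := by
    rw [hg']
    exact mul_le_of_le_one_right (by positivity) (by linarith)
  have hdiv : r ^ 2 * q ^ 4 / 2 ≤ 3 * g + -(s ^ 2 * (3 * r * q ^ 5 - 2 * r ^ 2 * q ^ 6)) := by
    have h1 : 3 * g + -(s ^ 2 * (3 * r * q ^ 5 - 2 * r ^ 2 * q ^ 6)) =
        r ^ 2 * q ^ 4 / 2 + r ^ 3 * q ^ 5 * (3 - 2 * (r * q)) +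
          (q ^ 2 * (r ^ 2 + s ^ 2) - 1) * (2 * r ^ 2 * q ^ 4 - 3 * r * q ^ 3) := by
      rw [hg]; ring
    rw [h1, hq2]
    have : 0 ≤ r ^ 3 * q ^ 5 * (3 - 2 * (r * q)) := mul_nonneg (by positivity) (by linarith)
    linarith
  have h2 : -(P * φ ^ 2) ≤ dθ * g * φ ^ 2 := by
    have := mul_le_mul_of_nonneg_right (abs_le.mp hdθ).1 (sq_nonneg φ)
    linarith
  have h3 : -(r ^ 2 * q ^ 4 * φ ^ 2 / 4 + 4 * D ^ 2) ≤ 2 * g * φ * dφ := by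
    have h4 : |g * dφ| ≤ r * q ^ 2 * D := by
      rw [abs_mul, abs_of_nonneg hg0]
      calc g * |dφ| ≤ r * q ^ 3 * (s * D) := by gcongr
        _ = r * q ^ 2 * D * (s * q) := by ring
        _ ≤ _ := mul_le_of_le_one_right (by positivity) hsq
    have h5 : (g * dφ) ^ 2 ≤ (r * q ^ 2 * D) ^ 2 := by
      rw [← sq_abs]
      gcongr
    have h6 : |2 * φ * (g * dφ)| ≤ 2 * |φ| * (r * q ^ 2 * D) := by
      rw [abs_mul, abs_mul, abs_two]
      gcongr
    have h7 := (abs_le.mp h6).1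
    have h8 : 0 ≤ (r * q ^ 2 * |φ| / 2 - 2 * D) ^ 2 := sq_nonneg _
    have h9 : (r * q ^ 2 * |φ| / 2 - 2 * D) ^ 2 =
        r ^ 2 * q ^ 4 * φ ^ 2 / 4 + 4 * D ^ 2 - 2 * |φ| * (r * q ^ 2 * D) := by
      rw [← sq_abs φ]; ring
    linarith
  have h4 := mul_le_mul_of_nonneg_left h3 hθ
  have h5 := mul_le_mul_of_nonneg_left hdiv (mul_nonneg hθ (sq_nonneg φ))
  nlinarith

/-- Cutting off at the scale of the inner ball costs at most the energy in the outer ball and the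
capacity density times the mass in the outer ball. -/
theorem exists_cutoff_integral_sq_fderiv_mul_le {κ : ℝ} (hκ : 1 < κ) : ∃ A : ℝ, 0 < A ∧
    ∀ (c : R3) (r ρ : ℝ), 0 < r → κ * r ≤ ρ → ∃ η : R3 → ℝ, ContDiff ℝ ∞ η ∧
      (∀ y ∈ Metric.closedBall c r, η y = 1) ∧
      ∀ φ : R3 → ℝ, ContDiff ℝ ∞ φ → HasCompactSupport φ →
        ∫ y, ‖fderiv ℝ (fun y => η y * φ y) y‖ ^ 2 ≤
          A * ∫ y in Metric.ball c ρ, (‖fderiv ℝ φ y‖ ^ 2 + r / ρ ^ 3 * φ y ^ 2) := by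
  -- The gap between r and ρ is split into two transitions of ratio √κ: η falls from 1 to 0 between
  -- r and rk, θ between ρ/k and ρ. Since rk ≤ ρ/k, θ is 1 wherever ∇η is nonzero.
  set k := √κ with hkdef
  have hk : 1 < k := Real.lt_sqrt_of_sq_lt (by linarith)
  have hk0 : 0 < k := by linarith
  have hkk : k ^ 2 = κ := Real.sq_sqrt (by linarith)
  obtain ⟨M, hM, hbump⟩ := exists_scaled_bump hk
  have hκ0 : 0 < κ := by linarith
  -- Factor 2 from squaring the product rule, M²(1+κ)² from comparing |∇η|² with r²q⁴ on |y - c| ≤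
  -- rk, and 4 from the quarter in `radial_weight_inequality`.
  set B := 2 * M ^ 2 * (1 + κ) ^ 2 * 4 with hB
  have hB0 : 0 < B := by positivity
  refine ⟨2 + B * (4 + M * κ), by positivity, fun c r ρ hr hρ => ?_⟩
  have hρ0 : 0 < ρ := lt_of_lt_of_le (by positivity) hρ
  have hrk : r * k ≤ ρ / k := by
    rw [le_div_iff₀ hk0]
    calc r * k * k = k ^ 2 * r := by ring
      _ ≤ ρ := by rwa [hkk]
  have hρk : ρ / k ≤ ρ := div_le_self hρ0.le hk.le
  obtain ⟨η, hη, hηc, hη01, hη1, hη0, hηd⟩ := hbump c (r * k) (by positivity)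
  obtain ⟨θ, hθ, hθc, hθ01, hθ1, hθ0, hθd⟩ := hbump c ρ hρ0
  refine ⟨η, hη, fun y hy => hη1 y ?_, fun φ hφ hφc => ?_⟩
  · rwa [mul_div_cancel_right₀ _ hk0.ne', ← dist_eq_norm]
  set q : R3 → ℝ := fun y => (√(r ^ 2 + ‖y - c‖ ^ 2))⁻¹ with hqdef
  have hpos : ∀ y : R3, 0 < r ^ 2 + ‖y - c‖ ^ 2 := fun y => by positivity
  have hq0 : ∀ y, 0 < q y := fun y => inv_pos.mpr (Real.sqrt_pos.mpr (hpos y))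
  have hq2 : ∀ y, q y ^ 2 * (r ^ 2 + ‖y - c‖ ^ 2) = 1 := fun y => by
    rw [hqdef]
    simp only [inv_pow]
    rw [Real.sq_sqrt (hpos y).le, inv_mul_cancel₀ (hpos y).ne']
  have hqC : ContDiff ℝ ∞ q :=
    ((contDiff_const.add ((contDiff_id.sub contDiff_const).norm_sq ℝ)).sqrt
      fun y => (hpos y).ne').inv fun y => (Real.sqrt_pos.mpr (hpos y)).ne'
  set g : R3 → ℝ := fun y => r * q y ^ 3 - r ^ 2 / 2 * q y ^ 4 with hgdef
  have hgC : ContDiff ℝ ∞ g :=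
    (contDiff_const.mul (hqC.pow 3)).sub (contDiff_const.mul (hqC.pow 4))
  set ψ : R3 → ℝ := fun y => θ y * g y * φ y ^ 2 with hψdef
  have hψ : ContDiff ℝ 1 ψ := ((hθ.mul hgC).mul (hφ.pow 2)).of_le (by simp)
  have hψc : HasCompactSupport ψ := hφc.of_eq_zero_imp fun y hy => by simp [hψdef, hy]
  have hder : ∀ y, fderiv ℝ ψ y (y - c) = fderiv ℝ θ y (y - c) * g y * φ y ^ 2 +
      θ y * (-(‖y - c‖ ^ 2 * (3 * r * q y ^ 5 - 2 * r ^ 2 * q y ^ 6))) * φ y ^ 2 +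
      2 * θ y * g y * φ y * fderiv ℝ φ y (y - c) := fun y => by
    obtain ⟨q', hq', hq'v⟩ := exists_hasFDerivAt_inv_sqrt hr c y
    have h1 : HasFDerivAt g _ y := ((hq'.pow 3).const_mul r).sub ((hq'.pow 4).const_mul (r ^ 2 / 2))
    have h2 := (hφ.differentiable (by simp) y).hasFDerivAt.pow 2
    have h3 := (hθ.differentiable (by simp) y).hasFDerivAt
    have h4 : HasFDerivAt ψ _ y := (h3.mul h1).mul h2
    rw [h4.fderiv]
    simp only [Pi.mul_apply, add_apply, smul_apply, sub_apply, smul_eq_mul, hq'v, nsmul_eq_mul]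
    simp only [hgdef, hqdef]
    push_cast
    ring
  -- The error from ∇θ lives in the shell ρ/k < |y - c| < ρ, where |∇θ| ≤ M/ρ, g ≤ rq³ and q ≤ k/ρ;
  -- this is where r/ρ³ comes from.
  have hw : ∀ y, θ y * (r ^ 2 * q y ^ 4) * φ y ^ 2 / 4 ≤ (3 * ψ y + fderiv ℝ ψ y (y - c)) +
      (4 * θ y * ‖fderiv ℝ φ y‖ ^ 2 +
        (Metric.ball c ρ).indicator (fun _ => M * κ * (r / ρ ^ 3)) y * φ y ^ 2) := fun y => by
    rw [hder]
    refine radial_weight_inequality hr (hq0 y) (hq2 y) (hθ01 y).1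
      (norm_nonneg _) ?_ ?_
    · change |fderiv ℝ θ y (y - c) * g y| ≤ _
      by_cases hy : θ y = 0 ∨ θ y = 1
      · rw [fderiv_eq_zero_of_eq_zero_of_nonneg hθ01 hy]
        simp only [zero_apply, zero_mul, abs_zero]
        exact Set.indicator_nonneg (fun _ _ => by positivity) y
      · push Not at hy
        have hyρ : ‖y - c‖ < ρ := not_le.mp fun h => hy.1 (hθ0 y h)
        have hyk : ρ / k < ‖y - c‖ := not_le.mp fun h => hy.2 (hθ1 y h)
        have hmem : y ∈ Metric.ball c ρ := by rwa [Metric.mem_ball, dist_eq_norm]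
        rw [Set.indicator_of_mem hmem, abs_mul]
        set s := ‖y - c‖
        have hs0 : 0 < s := lt_trans (by positivity) hyk
        have hsq : (s * q y) ^ 2 ≤ 1 := by
          have := hq2 y
          nlinarith [mul_nonneg (sq_nonneg (q y)) (sq_nonneg r)]
        have hsq1 : s * q y ≤ 1 := le_of_sq_le_sq (by simpa using hsq) zero_le_one
        have hrq1 : r * q y ≤ 1 := by
          refine le_of_sq_le_sq ?_ zero_le_one
          have := hq2 y
          nlinarith [mul_nonneg (sq_nonneg (q y)) (sq_nonneg s)]
        have hrq0 : 0 < r * q y := mul_pos hr (hq0 y)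
        have hgy : g y = r * q y ^ 3 * (1 - r * q y / 2) := by rw [hgdef]; ring
        have hg0 : 0 ≤ g y := by
          rw [hgy]
          have := hq0 y
          exact mul_nonneg (by positivity) (by linarith)
        have hg1 : g y ≤ r * q y ^ 3 := by
          rw [hgy]
          have := hq0 y
          exact mul_le_of_le_one_right (by positivity) (by linarith)
        have hd : |fderiv ℝ θ y (y - c)| ≤ M / ρ * s :=
          ((fderiv ℝ θ y).le_opNorm _).trans (by gcongr; exact hθd y)
        have hqk : q y ≤ k / ρ := by
          rw [le_div_iff₀ hρ0]
          have h1 : ρ ≤ s * k := by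
            rw [div_lt_iff₀ hk0] at hyk
            exact hyk.le
          calc q y * ρ ≤ q y * (s * k) := by gcongr
            _ = k * (s * q y) := by ring
            _ ≤ k := mul_le_of_le_one_right hk0.le hsq1
        rw [abs_of_nonneg hg0]
        have hq0y := hq0 y
        calc _ ≤ M / ρ * s * (r * q y ^ 3) := by gcongr
          _ = M / ρ * r * q y ^ 2 * (s * q y) := by ring
          _ ≤ M / ρ * r * q y ^ 2 := mul_le_of_le_one_right (by positivity) hsq1
          _ ≤ M / ρ * r * (k / ρ) ^ 2 := by gcongr
          _ = M * κ * (r / ρ ^ 3) := by rw [← hkk]; field_simp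
    · exact ((fderiv ℝ φ y).le_opNorm _).trans_eq (mul_comm _ _)
  set E : R3 → ℝ := fun y => ‖fderiv ℝ φ y‖ ^ 2 + r / ρ ^ 3 * φ y ^ 2 with hEdef
  have hpt : ∀ y, ‖fderiv ℝ (fun y => η y * φ y) y‖ ^ 2 ≤
      (2 + B * (4 + M * κ)) * (Metric.ball c ρ).indicator E y +
        B * (3 * ψ y + fderiv ℝ ψ y (y - c)) := fun y => by
    have hE0 : 0 ≤ ‖fderiv ℝ φ y‖ ^ 2 := sq_nonneg _
    have hE1 : 0 ≤ r / ρ ^ 3 * φ y ^ 2 := by positivity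
    have hEn : 0 ≤ (Metric.ball c ρ).indicator E y :=
      Set.indicator_nonneg (fun z _ => by positivity) y
    have h1 : HasFDerivAt (fun y => η y * φ y) _ y :=
      ((hη.differentiable (by simp) y).hasFDerivAt).mul
        ((hφ.differentiable (by simp) y).hasFDerivAt)
    have h2 : ‖fderiv ℝ (fun y => η y * φ y) y‖ ≤
        η y * ‖fderiv ℝ φ y‖ + |φ y| * ‖fderiv ℝ η y‖ := by
      rw [h1.fderiv]
      refine (norm_add_le _ _).trans_eq ?_
      rw [norm_smul, norm_smul, Real.norm_of_nonneg (hη01 y).1, Real.norm_eq_abs]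
    have h3 : ‖fderiv ℝ (fun y => η y * φ y) y‖ ^ 2 ≤
        2 * (η y * ‖fderiv ℝ φ y‖) ^ 2 + 2 * (φ y ^ 2 * ‖fderiv ℝ η y‖ ^ 2) := by
      have h4 : ‖fderiv ℝ (fun y => η y * φ y) y‖ ^ 2 ≤
          (η y * ‖fderiv ℝ φ y‖ + |φ y| * ‖fderiv ℝ η y‖) ^ 2 := by gcongr
      have h5 : φ y ^ 2 = |φ y| ^ 2 := (sq_abs _).symm
      rw [h5]
      nlinarith [sq_nonneg (η y * ‖fderiv ℝ φ y‖ - |φ y| * ‖fderiv ℝ η y‖)]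
    have h4 : (η y * ‖fderiv ℝ φ y‖) ^ 2 ≤ (Metric.ball c ρ).indicator E y := by
      by_cases hy : y ∈ Metric.ball c ρ
      · rw [Set.indicator_of_mem hy]
        have : η y * ‖fderiv ℝ φ y‖ ≤ ‖fderiv ℝ φ y‖ :=
          mul_le_of_le_one_left (norm_nonneg _) (hη01 y).2
        have h5 : (η y * ‖fderiv ℝ φ y‖) ^ 2 ≤ ‖fderiv ℝ φ y‖ ^ 2 := by
          have := (hη01 y).1
          gcongr
        simp only [hEdef]
        linarith
      · rw [Metric.mem_ball, not_lt, dist_eq_norm] at hy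
        rw [hη0 y ((hrk.trans hρk).trans hy)]
        simpa using hEn
    have h5 : 4 * θ y * ‖fderiv ℝ φ y‖ ^ 2 +
        (Metric.ball c ρ).indicator (fun _ => M * κ * (r / ρ ^ 3)) y * φ y ^ 2 ≤
        (4 + M * κ) * (Metric.ball c ρ).indicator E y := by
      by_cases hy : y ∈ Metric.ball c ρ
      · rw [Set.indicator_of_mem hy, Set.indicator_of_mem hy]
        simp only [hEdef]
        have h6 : 4 * θ y * ‖fderiv ℝ φ y‖ ^ 2 ≤ 4 * ‖fderiv ℝ φ y‖ ^ 2 := by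
          have := mul_le_of_le_one_left hE0 (hθ01 y).2
          linarith
        have h7 : 0 ≤ M * κ * ‖fderiv ℝ φ y‖ ^ 2 := by positivity
        nlinarith
      · rw [Set.indicator_of_notMem hy, Set.indicator_of_notMem hy]
        rw [Metric.mem_ball, not_lt, dist_eq_norm] at hy
        rw [hθ0 y hy]
        simp
    have h6 : 2 * (φ y ^ 2 * ‖fderiv ℝ η y‖ ^ 2) ≤
        B * (θ y * (r ^ 2 * q y ^ 4) * φ y ^ 2 / 4) := by
      by_cases hy : ‖y - c‖ ≤ r * k
      · rw [hθ1 y (hy.trans hrk), one_mul]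
        have h7 : ‖fderiv ℝ η y‖ ^ 2 ≤ (M / r) ^ 2 := by
          have : ‖fderiv ℝ η y‖ ≤ M / r :=
            (hηd y).trans (div_le_div_of_nonneg_left hM.le hr (le_mul_of_one_le_right hr.le hk.le))
          gcongr
        have h8 : 1 ≤ (1 + κ) * (r ^ 2 * q y ^ 2) := by
          have h9 : ‖y - c‖ ^ 2 ≤ r ^ 2 * κ := by
            rw [← hkk, ← mul_pow]
            gcongr
          have h10 : q y ^ 2 * (r ^ 2 + ‖y - c‖ ^ 2) ≤ q y ^ 2 * (r ^ 2 + r ^ 2 * κ) := by gcongr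
          rw [hq2] at h10
          linarith
        have h9 : (M / r) ^ 2 ≤ M ^ 2 * (1 + κ) ^ 2 * (r ^ 2 * q y ^ 4) := by
          have h10 : (1 : ℝ) ≤ ((1 + κ) * (r ^ 2 * q y ^ 2)) ^ 2 := one_le_pow₀ h8
          calc (M / r) ^ 2 ≤ (M / r) ^ 2 * ((1 + κ) * (r ^ 2 * q y ^ 2)) ^ 2 :=
                le_mul_of_one_le_right (sq_nonneg _) h10
            _ = _ := by field_simp
        have h11 := mul_le_mul_of_nonneg_left (h7.trans h9) (sq_nonneg (φ y))
        rw [hB]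
        linarith
      · rw [fderiv_eq_zero_of_eq_zero_of_nonneg hη01 (Or.inl (hη0 y (not_le.mp hy).le))]
        have := (hθ01 y).1
        have : 0 ≤ B * (θ y * (r ^ 2 * q y ^ 4) * φ y ^ 2 / 4) := by positivity
        simpa using this
    have h7 := mul_le_mul_of_nonneg_left (hw y) hB0.le
    have h8 := mul_le_mul_of_nonneg_left h5 hB0.le
    linarith
  have hEi : Integrable E := (integrable_sq_norm_fderiv hφ hφc).add
    (((hφ.continuous.pow 2).integrable_of_hasCompactSupport
      (hφc.of_eq_zero_imp fun y hy => by simp [hy])).const_mul _)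
  have hEi' := hEi.indicator (measurableSet_ball (x := c) (ε := ρ))
  have hψi := integrable_euler hψ hψc c
  have hmono := integral_mono (integrable_sq_norm_fderiv (hη.mul hφ) hφc.mul_left)
    ((hEi'.const_mul (2 + B * (4 + M * κ))).add (hψi.const_mul B)) hpt
  rw [integral_add' (hEi'.const_mul _) (hψi.const_mul B), integral_const_mul, integral_const_mul,
    integral_fderiv_apply_sub_center hψ hψc c, mul_zero, add_zero,
    integral_indicator measurableSet_ball] at hmono
  exact hmono

end LocalCutoff

/-! ### Density, closed subspaces and the Dirichlet problem as a projection. -/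

section HomogeneousSobolevSpace

namespace HDot1

theorem exists_of_contDiff {φ : R3 → ℝ} (hφ : ContDiff ℝ ∞ φ) (hc : HasCompactSupport φ) :
    ∃ u : HDot1, fn u =ᵐ[volume] φ ∧ grad u =ᵐ[volume] ∇ φ := by
  have h1 : MemLp φ 6 (volume : Measure R3) := hφ.continuous.memLp_of_hasCompactSupport hc
  have hg : HasCompactSupport (∇ φ) := (hc.fderiv ℝ).mono fun y hy h0 => hy (by simp [gradient, h0])
  have h2 : MemLp (∇ φ) 2 (volume : Measure R3) :=
    (continuous_gradient_of_contDiff hφ).memLp_of_hasCompactSupport hg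
  have hmem : ((h1.toLp φ, h2.toLp (∇ φ)) :
      Lp ℝ 6 (volume : Measure R3) × Lp R3 2 (volume : Measure R3)) ∈ testPairs :=
    ⟨φ, hφ, hc, h1.coeFn_toLp, h2.coeFn_toLp⟩
  exact ⟨⟨_, testPairs.le_topologicalClosure hmem⟩, h1.coeFn_toLp, h2.coeFn_toLp⟩

theorem norm_sq_eq_integral {φ : R3 → ℝ} {u : HDot1} (hu : grad u =ᵐ[volume] ∇ φ) :
    ‖u‖ ^ 2 = ∫ y, ‖fderiv ℝ φ y‖ ^ 2 := by
  rw [← real_inner_self_eq_norm_sq, inner_def, L2.inner_def]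
  refine integral_congr_ae ?_
  filter_upwards [hu] with y hy
  rw [real_inner_self_eq_norm_sq, hy, norm_gradient_eq]

theorem mem_closure_setOf_contDiff (u : HDot1) :
    u ∈ closure {v : HDot1 | ∃ φ : R3 → ℝ, ContDiff ℝ ∞ φ ∧ HasCompactSupport φ ∧
      fn v =ᵐ[volume] φ ∧ grad v =ᵐ[volume] ∇ φ} := by
  rw [Metric.mem_closure_iff]
  intro ε hε
  have hu : (u.1 : Lp ℝ 6 (volume : Measure R3) × Lp R3 2 (volume : Measure R3)) ∈
      closure (testPairs : Set _) := u.2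
  obtain ⟨p, ⟨φ, hφ, hc, h1, h2⟩, hp⟩ := Metric.mem_closure_iff.mp hu ε hε
  refine ⟨⟨p, testPairs.le_topologicalClosure ⟨φ, hφ, hc, h1, h2⟩⟩, ⟨φ, hφ, hc, h1, h2⟩, ?_⟩
  exact (le_max_right _ _).trans_lt (Prod.dist_eq.symm.trans_lt hp)

theorem continuous_fn : Continuous fn :=
  AddMonoidHomClass.continuous_of_bound fn sobolevConst norm_fn_le

end HDot1

/-- Convergence in Ḣ¹ gives convergence in L⁶, hence almost everywhere along a subsequence.
Closedness is what makes the kernel of each projection exactly Ḣ¹₀, not merely its closure. -/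
theorem isClosed_HDot1Zero (Ω : Set R3) : IsClosed (HDot1Zero Ω : Set HDot1) := by
  refine IsSeqClosed.isClosed fun s u hs hu => ?_
  have h1 : Tendsto (fun n => HDot1.fn (s n)) atTop (𝓝 (HDot1.fn u)) :=
    (HDot1.continuous_fn.tendsto u).comp hu
  obtain ⟨ns, -, hns⟩ := (tendstoInMeasure_of_tendsto_Lp h1).exists_seq_tendsto_ae
  have h2 : ∀ᵐ y ∂(volume : Measure R3), ∀ n, y ∉ Ω → HDot1.fn (s n) y = 0 :=
    ae_all_iff.mpr hs
  change ∀ᵐ y ∂(volume : Measure R3), y ∉ Ω → HDot1.fn u y = 0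
  filter_upwards [hns, h2] with y hy h2 hΩ
  refine tendsto_nhds_unique hy ?_
  simp only [h2 _ hΩ]
  exact tendsto_const_nhds

theorem reflectionProjection_eq_zero_iff (c : R3) (ρ : ℝ) (u : HDot1) :
    reflectionProjection c ρ u = 0 ↔ u ∈ HDot1Zero (Metric.closedBall c ρ)ᶜ := by
  rw [reflectionProjection, Submodule.starProjection_apply_eq_zero_iff,
    Submodule.orthogonal_orthogonal_eq_closure,
    IsClosed.submodule_topologicalClosure_eq (isClosed_HDot1Zero _)]

/-- `Q u` has the smallest energy among all functions that agree with `u` in the ball. -/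
theorem norm_reflectionProjection_le {c : R3} {ρ : ℝ} {u v : HDot1}
    (h : ∀ᵐ y ∂(volume : Measure R3), y ∈ Metric.closedBall c ρ → HDot1.fn u y = HDot1.fn v y) :
    ‖reflectionProjection c ρ u‖ ≤ ‖v‖ := by
  have h1 : u - v ∈ HDot1Zero (Metric.closedBall c ρ)ᶜ := by
    change ∀ᵐ y ∂(volume : Measure R3), _
    filter_upwards [h, Lp.coeFn_sub (HDot1.fn u) (HDot1.fn v)] with y hy hsub hyc
    rw [map_sub, hsub, Pi.sub_apply, hy (not_not.mp hyc), sub_self]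
  have h2 := (reflectionProjection_eq_zero_iff c ρ _).mpr h1
  rw [map_sub, sub_eq_zero] at h2
  rw [h2]
  exact Submodule.norm_starProjection_apply_le _ v

/-- Countability of the index set enters here, to combine the exceptional null sets. -/
theorem mem_HDot1Zero_compl_iUnion {I : Type*} [Countable I] (B : I → Set R3) (u : HDot1) :
    u ∈ HDot1Zero (⋃ i, B i)ᶜ ↔ ∀ i, u ∈ HDot1Zero (B i)ᶜ := by
  change (∀ᵐ y ∂(volume : Measure R3), _) ↔ ∀ i, ∀ᵐ y ∂(volume : Measure R3), _
  rw [← ae_all_iff]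
  refine eventually_congr (Eventually.of_forall fun y => ?_)
  simp only [Set.mem_compl_iff, not_not, Set.mem_iUnion, forall_exists_index]

theorem isDirichletSolution_iff (K : Set R3) (f : HDotNeg1) (u : HDot1) :
    IsDirichletSolution K f u ↔ u ∈ HDot1Zero Kᶜ ∧ ∀ v ∈ HDot1Zero Kᶜ, ⟪u, v⟫_ℝ = f v := by
  have hmem : u ∈ HDot1Zero Kᶜ ↔ ∀ᵐ y ∂(volume : Measure R3), y ∈ K → HDot1.fn u y = 0 := by
    change (∀ᵐ y ∂(volume : Measure R3), _) ↔ _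
    simp only [Set.mem_compl_iff, not_not]
  simp only [HDot1.inner_def, L2.inner_def]
  exact ⟨fun h => ⟨hmem.mpr h.1, h.2⟩, fun h => ⟨hmem.mp h.1, h.2⟩⟩

/-- By Riesz, f is the pairing with (-Δ)⁻¹f, so the weak equation says that (-Δ)⁻¹f - u is
orthogonal to Ḣ¹₀(ℝ³ ∖ K). Existence and uniqueness follow at once. -/
theorem isDirichletSolution_iff_eq_starProjection (K : Set R3)
    [(HDot1Zero Kᶜ).HasOrthogonalProjection] (f : HDotNeg1) (u : HDot1) :
    IsDirichletSolution K f u ↔ u = (HDot1Zero Kᶜ).starProjection (invNegLaplacian f) := by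
  have hf : ∀ v, f v = ⟪invNegLaplacian f, v⟫_ℝ := fun v =>
    (InnerProductSpace.toDual_symm_apply (y := f)).symm
  rw [isDirichletSolution_iff]
  constructor
  · rintro ⟨h1, h2⟩
    refine (Submodule.eq_starProjection_of_mem_of_inner_eq_zero h1 fun v hv => ?_).symm
    rw [inner_sub_left, ← hf, h2 v hv, sub_self]
  · rintro rfl
    refine ⟨Submodule.starProjection_apply_mem _ _, fun v hv => ?_⟩
    rw [hf, Submodule.inner_starProjection_left_eq_right,
      Submodule.starProjection_eq_self_iff.mpr hv]

end HomogeneousSobolevSpace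

/-! ### The uniform quadratic form bound for particle configurations. -/

section ParticleConfigurations

theorem nearestDist_le_edist {I : Type*} (x : I → R3) {i j : I} (h : j ≠ i) :
    nearestDist x i ≤ edist (x i) (x j) := iInf₂_le j h

/-- The particles are centered in disjoint balls of radii `ρ i ≤ 1/2`, which are either as large
as that or adapted to the capacity density. -/
theorem IsParticleConfig.exists_disjoint_balls {I : Type*} {x : I → R3} {r : I → ℝ} {μ₀ : ℝ≥0}
    {κ : ℝ} (h : IsParticleConfig x r μ₀ κ) :
    ∃ ρ : I → ℝ, (∀ i, 0 < ρ i ∧ ρ i ≤ 1 / 2) ∧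
      Pairwise (Function.onFun Disjoint fun i => Metric.ball (x i) (ρ i)) ∧
      ∀ i, ρ i = 1 / 2 ∨ (κ * r i ≤ ρ i ∧ r i / ρ i ^ 3 ≤ 8 * μ₀) := by
  have hpos : ∀ i, 0 < nearestDist x i := fun i => by
    have h1 := bot_le.trans_lt (h.separated i)
    exact (ENNReal.div_pos_iff.mp h1).1.bot_lt
  have hne : ∀ i, min (nearestDist x i) 1 ≠ (⊤ : ℝ≥0∞) := fun i => by simp
  -- Capping at 1 keeps the radius finite for a lone particle and keeps e^{-|x_i|} comparable to
  -- weights evaluated anywhere in the ball.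
  refine ⟨fun i => (min (nearestDist x i) 1).toReal / 2, fun i => ⟨?_, ?_⟩, fun i j hij => ?_,
    fun i => ?_⟩
  · have : 0 < (min (nearestDist x i) 1).toReal :=
      ENNReal.toReal_pos (lt_min (hpos i) one_pos).ne' (hne i)
    positivity
  · have : (min (nearestDist x i) 1).toReal ≤ 1 :=
      ENNReal.toReal_mono ENNReal.one_ne_top (min_le_right _ _)
    linarith
  · refine Metric.ball_disjoint_ball ?_
    have h1 : ∀ i j, i ≠ j → (min (nearestDist x i) 1).toReal ≤ dist (x i) (x j) := fun i j hij => by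
      rw [dist_edist]
      exact ENNReal.toReal_mono (edist_ne_top _ _)
        ((min_le_left _ _).trans (nearestDist_le_edist x hij.symm))
    have h2 := h1 i j hij
    have h3 := h1 j i hij.symm
    rw [dist_comm] at h3
    linarith
  · rcases le_or_gt 1 (nearestDist x i) with h1 | h1
    · left
      simp [min_eq_right h1]
    · right
      simp only [min_eq_left h1.le]
      have htop : nearestDist x i ≠ ⊤ := (h1.trans ENNReal.one_lt_top).ne
      obtain ⟨D, hD⟩ : ∃ D, D = (nearestDist x i).toReal := ⟨_, rfl⟩
      have hD0 : 0 < D := hD ▸ ENNReal.toReal_pos (hpos i).ne' htop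
      have hDe : nearestDist x i = ENNReal.ofReal D := by rw [hD, ENNReal.ofReal_toReal htop]
      rw [← hD]
      constructor
      · have h2 := h.separated i
        rw [hDe, ← ENNReal.ofReal_ofNat 2, ← ENNReal.ofReal_div_of_pos two_pos] at h2
        exact (ENNReal.ofReal_lt_ofReal_iff (by positivity)).mp h2 |>.le
      · have h2 := h.capacity i
        rw [hDe, ← ENNReal.ofReal_pow hD0.le, ← ENNReal.ofReal_div_of_pos (by positivity),
          ENNReal.ofReal_le_coe] at h2
        have h3 : r i / (D / 2) ^ 3 = 8 * (r i / D ^ 3) := by field_simp; norm_num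
        rw [h3]
        exact mul_le_mul_of_nonneg_left h2 (by norm_num)

theorem exp_neg_norm_le_two_mul {x y : R3} (h : ‖y - x‖ ≤ 1) :
    Real.exp (-‖x‖) ≤ 2 * (1 + ‖y‖ ^ 2)⁻¹ := by
  have h1 : ‖y‖ ≤ ‖x‖ + 1 := by
    have := norm_add_le x (y - x)
    rw [add_sub_cancel] at this
    linarith
  have h2 := Real.quadratic_le_exp_of_nonneg (norm_nonneg x)
  rw [Real.exp_neg, ← div_eq_mul_inv, inv_le_comm₀ (Real.exp_pos _) (by positivity), inv_div,
    div_le_iff₀ two_pos]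
  nlinarith [norm_nonneg x, norm_nonneg y]

/-- For isolated particles the weight itself is integrated over ℝ³, so the decay |y|⁻² of the
previous bound is not enough; applying the quadratic lower bound to exp(‖x‖/2) and squaring gives
|y|⁻⁴. -/
theorem exp_neg_norm_le_mul_sq {x y : R3} (h : ‖y - x‖ ≤ 1) :
    Real.exp (-‖x‖) ≤ 64 * ((1 + ‖y‖ ^ 2)⁻¹) ^ 2 := by
  have h1 : ‖y‖ ≤ ‖x‖ + 1 := by
    have := norm_add_le x (y - x)
    rw [add_sub_cancel] at this
    linarith
  have h2 := Real.quadratic_le_exp_of_nonneg (div_nonneg (norm_nonneg x) two_pos.le)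
  have h3 : Real.exp (-(‖x‖ / 2)) ≤ 8 * (1 + ‖y‖ ^ 2)⁻¹ := by
    rw [Real.exp_neg, ← div_eq_mul_inv, inv_le_comm₀ (Real.exp_pos _) (by positivity), inv_div,
      div_le_iff₀ (by norm_num)]
    nlinarith [norm_nonneg x, norm_nonneg y]
  calc Real.exp (-‖x‖) = Real.exp (-(‖x‖ / 2)) ^ 2 := by rw [← Real.exp_nat_mul]; ring_nf
    _ ≤ (8 * (1 + ‖y‖ ^ 2)⁻¹) ^ 2 := by gcongr
    _ = _ := by ring

theorem integrable_inv_one_add_norm_sq_sq :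
    Integrable fun y : R3 => ((1 + ‖y‖ ^ 2)⁻¹) ^ 2 := by
  have h := integrable_rpow_neg_one_add_norm_sq (E := R3) (μ := volume) (r := 4)
    (by rw [finrank_euclideanSpace_fin]; norm_num)
  refine h.congr (Eventually.of_forall fun y => ?_)
  change (1 + ‖y‖ ^ 2) ^ (-4 / 2 : ℝ) = ((1 + ‖y‖ ^ 2)⁻¹) ^ 2
  rw [show (-4 / 2 : ℝ) = -(2 : ℕ) by norm_num, Real.rpow_neg (by positivity), Real.rpow_natCast,
    inv_pow]

/-- Each summand is bounded by the integral over its own ball of one common density Φ; disjointness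
then bounds the sum by the integral of Φ over ℝ³. The three parts of C come from the gradient, from
Hardy's inequality (16 = 2·8, times the Hardy constant 4), and from the isolated particles. -/
theorem exists_sum_exp_mul_norm_sq_le (μ₀ : ℝ≥0) {κ : ℝ} (hκ : 1 < κ) : ∃ C : ℝ, 0 < C ∧
    ∀ {I : Type*} (x : I → R3) (r : I → ℝ), IsParticleConfig x r μ₀ κ →
      ∀ (s : Finset I) (u : HDot1),
        ∑ i ∈ s, Real.exp (-‖x i‖) * ‖reflectionProjection (x i) (r i) u‖ ^ 2 ≤ C * ‖u‖ ^ 2 := by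
  obtain ⟨A, hA, hcut⟩ := exists_cutoff_integral_sq_fderiv_mul_le hκ
  set D₀ := ∫ y : R3, ((1 + ‖y‖ ^ 2)⁻¹) ^ 2 with hD₀
  have hD₀0 : 0 ≤ D₀ := integral_nonneg fun y => by positivity
  set v₀ := volume.real (Metric.ball (0 : R3) (1 / 2)) with hv₀
  have hv₀0 : 0 < v₀ := 
    ENNReal.toReal_pos (Metric.measure_ball_pos _ _ (by norm_num)).ne' measure_ball_lt_top.ne
  refine ⟨A + 16 * A * μ₀ * 4 + 64 / v₀ * D₀, by positivity, fun {I} x r hconf s u => ?_⟩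
  obtain ⟨ρ, hρ, hdisj, hρr⟩ := hconf.exists_disjoint_balls
  -- For a finite sum both sides are continuous in u, so test functions suffice.
  refine closure_minimal (t := {u : HDot1 |
    ∑ i ∈ s, Real.exp (-‖x i‖) * ‖reflectionProjection (x i) (r i) u‖ ^ 2 ≤
      (A + 16 * A * μ₀ * 4 + 64 / v₀ * D₀) * ‖u‖ ^ 2}) ?_ ?_ (HDot1.mem_closure_setOf_contDiff u)
  swap
  · refine isClosed_le (continuous_finsetSum _ fun i _ => ?_) (by fun_prop)
    exact (((reflectionProjection (x i) (r i)).continuous.norm.pow 2).const_mul _)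
  rintro u ⟨φ, hφ, hφc, hfn, hgrad⟩
  have hnorm := HDot1.norm_sq_eq_integral hgrad
  have hi1 := integrable_sq_norm_fderiv hφ hφc
  have hi2 := integrable_inv_one_add_norm_sq_mul_sq hφ hφc
  have hi3 := integrable_inv_one_add_norm_sq_sq
  have hi4 : Integrable fun y => φ y ^ 2 := (hφ.continuous.pow 2).integrable_of_hasCompactSupport
    (hφc.of_eq_zero_imp fun y hy => by simp [hy])
  set Φ : R3 → ℝ := fun y => A * ‖fderiv ℝ φ y‖ ^ 2 +
    16 * A * μ₀ * ((1 + ‖y‖ ^ 2)⁻¹ * φ y ^ 2) +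
    64 / v₀ * ‖u‖ ^ 2 * ((1 + ‖y‖ ^ 2)⁻¹) ^ 2 with hΦ
  have hi12 := (hi1.const_mul A).add (hi2.const_mul (16 * A * μ₀))
  have hΦi : Integrable Φ := hi12.add (hi3.const_mul (64 / v₀ * ‖u‖ ^ 2))
  have hΦ0 : ∀ y, 0 ≤ Φ y := fun y => by positivity
  have hΦint : ∫ y, Φ y ≤ (A + 16 * A * μ₀ * 4 + 64 / v₀ * D₀) * ‖u‖ ^ 2 := by
    have h1 : ∫ y, Φ y = A * (∫ y, ‖fderiv ℝ φ y‖ ^ 2) +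
        16 * A * μ₀ * (∫ y, (1 + ‖y‖ ^ 2)⁻¹ * φ y ^ 2) + 64 / v₀ * ‖u‖ ^ 2 * D₀ := by
      rw [← integral_const_mul, ← integral_const_mul, hD₀, ← integral_const_mul,
        ← integral_add (hi1.const_mul A) (hi2.const_mul _)]
      exact integral_add hi12 (hi3.const_mul _)
    have h2 := mul_le_mul_of_nonneg_left (integral_inv_one_add_norm_sq_mul_sq_le hφ hφc)
      (by positivity : 0 ≤ 16 * A * μ₀)
    rw [h1]
    rw [← hnorm] at h2 ⊢
    linarith
  have hlocal : ∀ i, Real.exp (-‖x i‖) * ‖reflectionProjection (x i) (r i) u‖ ^ 2 ≤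
      ∫ y in Metric.ball (x i) (ρ i), Φ y := by
    intro i
    have hball : ∀ y ∈ Metric.ball (x i) (ρ i), ‖y - x i‖ ≤ 1 := fun y hy => by
      rw [Metric.mem_ball, dist_eq_norm] at hy
      linarith [(hρ i).2]
    rcases hρr i with h | ⟨h1, h2⟩
    -- Here the particle may be larger than the ball of radius 1/2, so no cutoff inside the ball is
    -- available; the constant bound is spread over the fixed volume v₀ instead.
    · have hQ : ‖reflectionProjection (x i) (r i) u‖ ≤ ‖u‖ :=
        Submodule.norm_starProjection_apply_le _ u
      have hv : volume.real (Metric.ball (x i) (ρ i)) = v₀ := by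
        rw [hv₀, h, Measure.real, Measure.real, Measure.addHaar_ball_center]
      calc _ ≤ Real.exp (-‖x i‖) * ‖u‖ ^ 2 := by gcongr
        _ = ∫ y in Metric.ball (x i) (ρ i), Real.exp (-‖x i‖) * ‖u‖ ^ 2 / v₀ := by
            rw [setIntegral_const, hv, smul_eq_mul, mul_div_cancel₀ _ hv₀0.ne']
        _ ≤ _ := by
            refine setIntegral_mono_on (integrableOn_const measure_ball_lt_top.ne)
              hΦi.integrableOn measurableSet_ball fun y hy => ?_
            have h3 := exp_neg_norm_le_mul_sq (hball y hy)
            calc Real.exp (-‖x i‖) * ‖u‖ ^ 2 / v₀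
                ≤ 64 * ((1 + ‖y‖ ^ 2)⁻¹) ^ 2 * ‖u‖ ^ 2 / v₀ := by gcongr
              _ = 64 / v₀ * ‖u‖ ^ 2 * ((1 + ‖y‖ ^ 2)⁻¹) ^ 2 := by ring
              _ ≤ Φ y := le_add_of_nonneg_left (by positivity)
    -- ηφ agrees with φ on the particle and so competes in the minimization that characterizes Q_i
    -- u.
    · obtain ⟨η, hη, hη1, hηint⟩ := hcut (x i) (r i) (ρ i) (hconf.radius_pos i) h1
      obtain ⟨v, hv, hvg⟩ := HDot1.exists_of_contDiff (hη.mul hφ) hφc.mul_left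
      have hQ : ‖reflectionProjection (x i) (r i) u‖ ≤ ‖v‖ := by
        refine norm_reflectionProjection_le ?_
        filter_upwards [hfn, hv] with y hy1 hy2 hyb
        rw [hy1, hy2, hη1 y hyb, one_mul]
      have hvn := HDot1.norm_sq_eq_integral hvg
      have hexp : Real.exp (-‖x i‖) ≤ 1 := Real.exp_le_one_iff.mpr (by simp)
      calc _ ≤ Real.exp (-‖x i‖) * ‖v‖ ^ 2 := by gcongr
        _ ≤ Real.exp (-‖x i‖) * (A * ∫ y in Metric.ball (x i) (ρ i),
              (‖fderiv ℝ φ y‖ ^ 2 + r i / ρ i ^ 3 * φ y ^ 2)) := by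
            gcongr
            exact hvn.trans_le (hηint φ hφ hφc)
        _ = ∫ y in Metric.ball (x i) (ρ i), Real.exp (-‖x i‖) * A *
              (‖fderiv ℝ φ y‖ ^ 2 + r i / ρ i ^ 3 * φ y ^ 2) := by
            rw [integral_const_mul, mul_assoc]
        _ ≤ _ := by
            refine setIntegral_mono_on
              ((hi1.add (hi4.const_mul (r i / ρ i ^ 3))).const_mul _).integrableOn
              hΦi.integrableOn measurableSet_ball fun y hy => ?_
            have h3 := exp_neg_norm_le_two_mul (hball y hy)
            have h4 : Real.exp (-‖x i‖) * A * ‖fderiv ℝ φ y‖ ^ 2 ≤ A * ‖fderiv ℝ φ y‖ ^ 2 := by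
              gcongr
              exact mul_le_of_le_one_left hA.le hexp
            have hr0 := hconf.radius_pos i
            have hρ0 := (hρ i).1
            have h5 : Real.exp (-‖x i‖) * A * (r i / ρ i ^ 3 * φ y ^ 2) ≤
                16 * A * μ₀ * ((1 + ‖y‖ ^ 2)⁻¹ * φ y ^ 2) := by
              calc _ ≤ 2 * (1 + ‖y‖ ^ 2)⁻¹ * A * (8 * μ₀ * φ y ^ 2) := by gcongr
                _ = _ := by ring
            have h6 : 0 ≤ 64 / v₀ * ‖u‖ ^ 2 * ((1 + ‖y‖ ^ 2)⁻¹) ^ 2 := by positivity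
            simp only [hΦ]
            rw [mul_add]
            linarith
  calc _ ≤ ∑ i ∈ s, ∫ y in Metric.ball (x i) (ρ i), Φ y := Finset.sum_le_sum fun i _ => hlocal i
    _ = ∫ y in ⋃ i ∈ s, Metric.ball (x i) (ρ i), Φ y :=
        (integral_biUnion_finset s (fun i _ => measurableSet_ball)
          (fun i _ j _ hij => hdisj hij) fun i _ => hΦi.integrableOn).symm
    _ ≤ ∫ y, Φ y := setIntegral_le_integral hΦi (Eventually.of_forall hΦ0)
    _ ≤ _ := hΦint

end ParticleConfigurations

/-! ### Convergence to the Dirichlet solution. -/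

theorem theorem3 (μ₀ : ℝ≥0) (κ : ℝ) (hκ : 1 < κ) :
    ∃ γ₀ : ℝ, 0 < γ₀ ∧
      ∀ {I : Type*} [Countable I] (x : I → R3) (r : I → ℝ), IsParticleConfig x r μ₀ κ →
        ∃ L : HDot1 →L[ℝ] HDot1,
          (∀ u : HDot1,
            HasSum (fun j => Real.exp (-‖x j‖) • reflectionProjection (x j) (r j) u) (L u)) ∧
          ∀ f : HDotNeg1,
            ∃ u : HDot1,
              IsDirichletSolution (⋃ j, Metric.closedBall (x j) (r j)) f u ∧
              (∀ w : HDot1,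
                IsDirichletSolution (⋃ j, Metric.closedBall (x j) (r j)) f w → w = u) ∧
              ∀ γ : ℝ, 0 < γ → γ < γ₀ →
                Tendsto (fun N : ℕ =>
                  ((ContinuousLinearMap.id ℝ HDot1 - γ • L) ^ N) (invNegLaplacian f))
                  atTop (𝓝 u) := by
  obtain ⟨C, hC, hb⟩ := exists_sum_exp_mul_norm_sq_le μ₀ hκ
  refine ⟨1 / C, by positivity, fun {I} _ x r hconf => ?_⟩
  obtain ⟨L, hL, hsymm, hq, hker⟩ := exists_hasSum_smul_starProjection
    (fun i => (HDot1Zero (Metric.closedBall (x i) (r i))ᶜ)ᗮ) (fun i => Real.exp_pos (-‖x i‖)) hC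
    (hb x r hconf)
  set K := ⋃ j, Metric.closedBall (x j) (r j) with hK
  -- This identifies the abstract limit: a function is annihilated by every Q_j exactly when it
  -- vanishes on every particle.
  have hkerK : (L : HDot1 →ₗ[ℝ] HDot1).ker = HDot1Zero Kᶜ := by
    ext u
    rw [hK, mem_HDot1Zero_compl_iUnion]
    exact (hker u).trans (forall_congr' fun i => reflectionProjection_eq_zero_iff _ _ _)
  have : CompleteSpace (HDot1Zero Kᶜ) := (isClosed_HDot1Zero _).completeSpace_coe
  refine ⟨L, hL, fun f => ⟨(HDot1Zero Kᶜ).starProjection (invNegLaplacian f),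
    (isDirichletSolution_iff_eq_starProjection K f _).mpr rfl,
    fun w hw => (isDirichletSolution_iff_eq_starProjection K f w).mp hw, fun γ hγ hγ₀ => ?_⟩⟩
  have h := tendsto_pow_id_sub_smul hsymm hC hq hγ hγ₀ (invNegLaplacian f)
  simp only [hkerK] at h
  exact h
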